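/- Let $T,\alpha,\beta>0$. Let $\mathrm{BV}(0,T)$ be the space of real functions $u\in L^1(0,T)$ whose distributional derivative $Du$ is a finite signed Radon measure on $(0,T)$, let $\|\cdot\|_M$ denote the total variation norm of such measures, and for $u\in\mathrm{BV}(0,T)$ let $$\operatorname{TGV}(u)=\inf_{w\in\mathrm{BV}(0,T)}\alpha\|Du-w\|_M+\beta\|Dw\|_M,\qquad B=\{u\in\mathrm{BV}(0,T)\mid\operatorname{TGV}(u)\le 1\}.$$ (Here $w$ is identified with the measure $w\,\mathrm{d}x$.) For $x\in(0,T)$ let $S_x=1_{(x,T)}$, and let $K_x(t)=1_{(0,x)}(t)\,(x-t)$ if $x<T/2$ and $K_x(t)=1_{(x,T)}(t)\,(t-x)$ if $x\ge T/2$. Put $$\operatorname{Ext}B:=\{\pm S_x/\alpha\mid x\in(0,T)\}\cup\{\pm K_x/\beta\mid x\in(\beta/\alpha,\,T-\beta/\alpha)\},$$ where the second set is empty if $\beta/\alpha\ge T/2$. Let $\varphi\in L^2(0,T)$ satisfy $(\varphi,\ell)_{L^2}=0$ for every affine function $\ell(x)=cx+d$, $c,d\in\mathbb R$. Then $B\subset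 L^2(0,T)$, so that $(\varphi,v)_{L^2}=\int_0^T\varphi v\,\mathrm{d}x$ is well defined for $v\in B$; the problem $\inf_{v\in B}(\varphi,v)_{L^2}$ has a minimizer in $B$; the minimum over $\operatorname{Ext}B$ is attained as well; and $$\min_{v\in B}(\varphi,v)_{L^2}=\min_{v\in\operatorname{Ext}B}(\varphi,v)_{L^2}.$$ -/

import Mathlib

open MeasureTheory Set
open scoped ContDiff

namespace TGVLinear

/-- `μ` represents the distributional derivative of `u` on `(0,T)`: here `u ∈ L¹(0,T)`, `μ` is a
finite signed Borel measure, and `∫₀ᵀ u ψ' = -∫ ψ dμ` for all `ψ ∈ C_c^∞(0,T)`.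
Finite signed measures on `(0,T)` are written as restrictions of signed measures on `ℝ`; only the
restriction of `μ` to `(0,T)` matters here (test functions vanish outside a compact subset of
`(0,T)`), and it is determined by `u`. Functions on `(0,T)` are written as functions on `ℝ`, whose
values outside `(0,T)` never matter. -/
def HasMeasureDeriv (T : ℝ) (u : ℝ → ℝ) (μ : SignedMeasure ℝ) : Prop :=
  IntegrableOn u (Ioo 0 T) volume ∧
    ∀ ψ : ℝ → ℝ, ContDiff ℝ ∞ ψ → HasCompactSupport ψ → tsupport ψ ⊆ Ioo 0 T →
      ∫ x in Ioo 0 T, u x * deriv ψ x = -∫ᵛ x, ψ x ∂•μ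

/-- `BV(0,T)`: the integrable functions whose distributional derivative is a finite measure. -/
def BV (T : ℝ) : Set (ℝ → ℝ) :=
  {u | ∃ μ : SignedMeasure ℝ, HasMeasureDeriv T u μ}

/-- The norm `‖μ‖_M` of the space `M(0,T)`: the total variation of `μ` on `(0,T)`. -/
noncomputable def radonNorm (T : ℝ) (μ : SignedMeasure ℝ) : ENNReal :=
  μ.variation (Ioo 0 T)

/-- The function `w ∈ L¹(0,T)` regarded as the measure `w dx` on `(0,T)`. -/
noncomputable def densityMeasure (T : ℝ) (w : ℝ → ℝ) : SignedMeasure ℝ :=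
  (volume.restrict (Ioo 0 T)).withDensityᵥ w

/-- The total generalized variation of order two,
`TGV(u) = inf_{w ∈ BV(0,T)} α ‖Du - w‖_M + β ‖Dw‖_M`, where `μ = Du` and `ν = Dw`
(and `TGV(u) = ∞` if `u` is not in `BV(0,T)`). -/
noncomputable def TGV (T α β : ℝ) (u : ℝ → ℝ) : ENNReal :=
  ⨅ (μ : SignedMeasure ℝ) (w : ℝ → ℝ) (ν : SignedMeasure ℝ)
    (_ : HasMeasureDeriv T u μ) (_ : HasMeasureDeriv T w ν),
    ENNReal.ofReal α * radonNorm T (μ - densityMeasure T w) +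
      ENNReal.ofReal β * radonNorm T ν

/-- The TGV ball `B = {u ∈ BV(0,T) | TGV(u) ≤ 1}`. -/
def tgvBall (T α β : ℝ) : Set (ℝ → ℝ) :=
  {u | u ∈ BV T ∧ TGV T α β u ≤ 1}

/-- The jump function `S_x = 1_{(x,T)}`. -/
noncomputable def jumpFn (T x : ℝ) : ℝ → ℝ :=
  (Ioo x T).indicator (fun _ => 1)

/-- The kink function: `K_x(t) = 1_{(0,x)}(t) (x - t)` if `x < T/2`, and
`K_x(t) = 1_{(x,T)}(t) (t - x)` if `x ≥ T/2`. -/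
noncomputable def kinkFn (T x : ℝ) : ℝ → ℝ :=
  if x < T / 2 then (Ioo 0 x).indicator (fun t => x - t)
  else (Ioo x T).indicator (fun t => t - x)

/-- `𝒮 = {± S_x / α | x ∈ (0,T)}`. -/
def jumpSet (T α : ℝ) : Set (ℝ → ℝ) :=
  {u | ∃ x ∈ Ioo 0 T, u = α⁻¹ • jumpFn T x ∨ u = -(α⁻¹ • jumpFn T x)}

/-- `𝒦 = {± K_x / β | x ∈ (β/α, T - β/α)}`. -/
def kinkSet (T α β : ℝ) : Set (ℝ → ℝ) :=
  {u | ∃ x ∈ Ioo (β / α) (T - β / α), u = β⁻¹ • kinkFn T x ∨ u = -(β⁻¹ • kinkFn T x)}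

/-- `Ext B = 𝒮 ∪ 𝒦`. -/
def extB (T α β : ℝ) : Set (ℝ → ℝ) :=
  jumpSet T α ∪ kinkSet T α β

/-- The pairing `(φ, v)_{L²(0,T)} = ∫₀ᵀ φ v`. -/
noncomputable def pairing (T : ℝ) (φ v : ℝ → ℝ) : ℝ :=
  ∫ x in Ioo 0 T, φ x * v x

end TGVLinear

namespace TGVLinear

/-! The argument is linear duality with an explicit certificate. Put Φ(y) = ∫_y^T φ and Ψ(y) = ∫_y^T
Φ. Orthogonality to affine functions makes Φ and Ψ vanish at 0 and T, so two integrations by parts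
give (φ,u) = ∫ Φ d(Du - w) + ∫ Ψ dDw for every w in BV (`pairing_eq`). With M = max(‖Φ‖∞/α, ‖Ψ‖∞/β)
this yields |(φ,u)| ≤ M on the ball (`enorm_pairing_le`).

The bound is attained on the candidate set, since (φ,S_x) = Φ(x) and (φ,K_x) = Ψ(x). If the Φ-term
dominates, a jump at a maximum point of |Φ| works. Otherwise ‖Ψ‖∞ > ‖Φ‖∞ β/α, while |Ψ(x)| ≤ ‖Φ‖∞
min(x, T - x) (`abs_tailInt_le`), so a maximum point of |Ψ| lies in (β/α, T - β/α) and a kink there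
works. No weak compactness is needed. -/

/-! ### Signed measures and tail integrals. -/

instance isFiniteMeasure_variation {X : Type*} [MeasurableSpace X] (μ : SignedMeasure X) :
    IsFiniteMeasure μ.variation := by
  rw [← SignedMeasure.totalVariation_eq_variation]; infer_instance

/-- The tail integral `y ↦ ∫_y^T h`. -/
noncomputable def tailInt (T : ℝ) (h : ℝ → ℝ) (y : ℝ) : ℝ := ∫ x in Ioo y T, h x

theorem lsmul_flip_real :
    (ContinuousLinearMap.lsmul ℝ ℝ : ℝ →L[ℝ] ℝ →L[ℝ] ℝ).flip = ContinuousLinearMap.lsmul ℝ ℝ := by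
  ext; simp

theorem integral_toSignedMeasure_real {X : Type*} [MeasurableSpace X] (p : Measure X)
    [IsFiniteMeasure p] (f : X → ℝ) : ∫ᵛ x, f x ∂•p.toSignedMeasure = ∫ x, f x ∂p := by
  rw [← VectorMeasure.integral_toSignedMeasure, lsmul_flip_real]

theorem toSignedMeasure_integrable {X : Type*} [MeasurableSpace X] {p : Measure X}
    [IsFiniteMeasure p] {f : X → ℝ} (hf : Integrable f p) :
    p.toSignedMeasure.Integrable f := by
  simpa [VectorMeasure.Integrable] using hf

theorem integral_toSignedMeasure_sub {X : Type*} [MeasurableSpace X] (p n : Measure X)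
    [IsFiniteMeasure p] [IsFiniteMeasure n] {f : X → ℝ} (hp : Integrable f p)
    (hn : Integrable f n) :
    ∫ᵛ x, f x ∂•(p.toSignedMeasure - n.toSignedMeasure) = ∫ x, f x ∂p - ∫ x, f x ∂n := by
  rw [VectorMeasure.integral_sub_vectorMeasure (toSignedMeasure_integrable hp)
    (toSignedMeasure_integrable hn), integral_toSignedMeasure_real, integral_toSignedMeasure_real]

/-- A signed measure is a difference of finite measures. -/
theorem exists_eq_toSignedMeasure_sub {X : Type*} [MeasurableSpace X]
    (μ : SignedMeasure X) : ∃ (p n : Measure X) (_ : IsFiniteMeasure p) (_ : IsFiniteMeasure n),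
      μ = p.toSignedMeasure - n.toSignedMeasure :=
  ⟨_, _, μ.toJordanDecomposition.posPart_finite, μ.toJordanDecomposition.negPart_finite,
    (μ.toSignedMeasure_toJordanDecomposition).symm⟩

theorem tailInt_eq_sub {T : ℝ} {h : ℝ → ℝ} (hh : IntegrableOn h (Ioo 0 T)) {y : ℝ}
    (h0 : 0 ≤ y) (hT : y ≤ T) : tailInt T h y = tailInt T h 0 - ∫ x in 0..y, h x := by
  have h1 : IntervalIntegrable h volume 0 y :=
    (intervalIntegrable_iff_integrableOn_Ioo_of_le h0).2 (hh.mono_set (Ioo_subset_Ioo_right hT))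
  have h2 : IntervalIntegrable h volume y T :=
    (intervalIntegrable_iff_integrableOn_Ioo_of_le hT).2 (hh.mono_set (Ioo_subset_Ioo_left h0))
  have := intervalIntegral.integral_add_adjacent_intervals h1 h2
  simp only [tailInt, ← integral_Ioc_eq_integral_Ioo, ← intervalIntegral.integral_of_le hT,
    ← intervalIntegral.integral_of_le (h0.trans hT)]
  linarith

theorem tailInt_self (T : ℝ) (h : ℝ → ℝ) : tailInt T h T = 0 := by simp [tailInt]

theorem continuousOn_tailInt {T : ℝ} (hT : 0 < T) {h : ℝ → ℝ} (hh : IntegrableOn h (Ioo 0 T)) :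
    ContinuousOn (tailInt T h) (Icc 0 T) := by
  have h1 : IntegrableOn h (uIcc 0 T) := by
    rw [uIcc_of_le hT.le]; exact (integrableOn_Icc_iff_integrableOn_Ioo).2 hh
  have := intervalIntegral.continuousOn_primitive_interval h1
  rw [uIcc_of_le hT.le] at this
  exact (continuousOn_const.sub this).congr fun y hy => tailInt_eq_sub hh hy.1 hy.2

theorem integrableOn_tailInt {T : ℝ} (hT : 0 < T) {h : ℝ → ℝ} (hh : IntegrableOn h (Ioo 0 T)) :
    IntegrableOn (tailInt T h) (Ioo 0 T) :=
  ((continuousOn_tailInt hT hh).integrableOn_compact isCompact_Icc).mono_set Ioo_subset_Icc_self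

theorem aestronglyMeasurable_tailInt {T : ℝ} (hT : 0 < T) {h : ℝ → ℝ}
    (hh : IntegrableOn h (Ioo 0 T)) (p : Measure ℝ) :
    AEStronglyMeasurable (tailInt T h) (p.restrict (Ioo 0 T)) :=
  ((continuousOn_tailInt hT hh).mono Ioo_subset_Icc_self).aestronglyMeasurable measurableSet_Ioo

theorem exists_bound_tailInt {T : ℝ} (hT : 0 < T) {h : ℝ → ℝ} (hh : IntegrableOn h (Ioo 0 T)) :
    ∃ C, ∀ y ∈ Icc 0 T, ‖tailInt T h y‖ ≤ C :=
  isCompact_Icc.exists_bound_of_continuousOn (continuousOn_tailInt hT hh)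

theorem integrableOn_tailInt_measure {T : ℝ} (hT : 0 < T) {h : ℝ → ℝ}
    (hh : IntegrableOn h (Ioo 0 T)) (p : Measure ℝ) [IsFiniteMeasure p] :
    IntegrableOn (tailInt T h) (Ioo 0 T) p := by
  obtain ⟨C, hC⟩ := exists_bound_tailInt hT hh
  exact Integrable.of_bound (aestronglyMeasurable_tailInt hT hh p) C
    ((ae_restrict_iff' measurableSet_Ioo).2 (.of_forall fun y hy => hC y (Ioo_subset_Icc_self hy)))

theorem integrableOn_tailInt_signed {T : ℝ} (hT : 0 < T) {h : ℝ → ℝ}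
    (hh : IntegrableOn h (Ioo 0 T)) (μ : SignedMeasure ℝ) :
    μ.IntegrableOn (tailInt T h) (Ioo 0 T) := by
  rw [VectorMeasure.IntegrableOn, VectorMeasure.Integrable,
    VectorMeasure.variation_restrict measurableSet_Ioo]
  exact integrableOn_tailInt_measure hT hh _

/-! ### Fubini for distribution functions, and densities. -/

theorem integral_mul_measureReal {T : ℝ} {h : ℝ → ℝ}
    (hh : IntegrableOn h (Ioo 0 T)) (p : Measure ℝ) [IsFiniteMeasure p] :
    ∫ x in Ioo 0 T, h x * p.real (Ioo 0 x) = ∫ y in Ioo 0 T, tailInt T h y ∂p := by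
  -- Both sides are the integral of h(x) over the triangle y < x.
  let S : Set (ℝ × ℝ) := {z | z.2 < z.1}
  have hS : MeasurableSet S := measurableSet_lt measurable_snd measurable_fst
  have hint : Integrable (Function.uncurry fun x y => S.indicator (fun z => h z.1) (x, y))
      ((volume.restrict (Ioo 0 T)).prod (p.restrict (Ioo 0 T))) := by
    have : Integrable (fun z : ℝ × ℝ => h z.1)
        ((volume.restrict (Ioo 0 T)).prod (p.restrict (Ioo 0 T))) := hh.integrable.comp_fst _
    exact this.indicator hS
  have key := integral_integral_swap hint
  have e1 : ∫ x in Ioo 0 T, h x * p.real (Ioo 0 x) =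
      ∫ x in Ioo 0 T, ∫ y in Ioo 0 T, S.indicator (fun z => h z.1) (x, y) ∂p := by
    refine setIntegral_congr_fun measurableSet_Ioo fun x hx => ?_
    have : ∀ y, S.indicator (fun z => h z.1) (x, y) = (Iio x).indicator (fun _ => h x) y := by
      intro y; simp [S, indicator]
    simp only [this]
    rw [setIntegral_indicator measurableSet_Iio, Ioo_inter_Iio, min_eq_right hx.2.le]
    simp [mul_comm]
  have e2 : ∫ y in Ioo 0 T, tailInt T h y ∂p =
      ∫ y in Ioo 0 T, (∫ x in Ioo 0 T, S.indicator (fun z => h z.1) (x, y)) ∂p := by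
    refine setIntegral_congr_fun measurableSet_Ioo fun y hy => ?_
    have : ∀ x, S.indicator (fun z => h z.1) (x, y) = (Ioi y).indicator h x := by
      intro x; simp [S, indicator]
    simp only [this]
    rw [setIntegral_indicator measurableSet_Ioi, Ioo_inter_Ioi, max_eq_right hy.1.le, tailInt]
  exact (e1.trans key).trans e2.symm

theorem measurable_measureReal_Ioo (p : Measure ℝ) [IsFiniteMeasure p] :
    Measurable fun x => p.real (Ioo 0 x) := by
  refine Monotone.measurable fun x y hxy => ?_
  exact measureReal_mono (Ioo_subset_Ioo_right hxy)

theorem measurable_signed_Ioo (μ : SignedMeasure ℝ) : Measurable fun x => μ (Ioo 0 x) := by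
  obtain ⟨p, n, _, _, rfl⟩ := exists_eq_toSignedMeasure_sub μ
  simp only [Measure.toSignedMeasure_sub_apply measurableSet_Ioo]
  exact (measurable_measureReal_Ioo p).sub (measurable_measureReal_Ioo n)

theorem integrableOn_mul_signed {T : ℝ} {h : ℝ → ℝ} (hh : IntegrableOn h (Ioo 0 T))
    (μ : SignedMeasure ℝ) : IntegrableOn (fun x => h x * μ (Ioo 0 x)) (Ioo 0 T) :=
  hh.integrable.mul_bdd (c := μ.bound) (measurable_signed_Ioo μ).aestronglyMeasurable
    (.of_forall fun _ => VectorMeasure.norm_apply_le_bound)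

theorem setIntegral_toSignedMeasure_sub {X : Type*} [MeasurableSpace X] (p n : Measure X)
    [IsFiniteMeasure p] [IsFiniteMeasure n] {s : Set X} (hs : MeasurableSet s) {f : X → ℝ}
    (hp : IntegrableOn f s p) (hn : IntegrableOn f s n) :
    ∫ᵛ x in s, f x ∂•(p.toSignedMeasure - n.toSignedMeasure) =
      ∫ x in s, f x ∂p - ∫ x in s, f x ∂n := by
  rw [VectorMeasure.restrict_sub, VectorMeasure.restrict_toSignedMeasure hs,
    VectorMeasure.restrict_toSignedMeasure hs, integral_toSignedMeasure_sub _ _ hp hn]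

/-- Fubini's theorem for the distribution function of a signed measure. -/
theorem integral_mul_signed {T : ℝ} (hT : 0 < T) {h : ℝ → ℝ} (hh : IntegrableOn h (Ioo 0 T))
    (μ : SignedMeasure ℝ) :
    ∫ x in Ioo 0 T, h x * μ (Ioo 0 x) = ∫ᵛ y in Ioo 0 T, tailInt T h y ∂•μ := by
  obtain ⟨p, n, _, _, rfl⟩ := exists_eq_toSignedMeasure_sub μ
  have hb : ∀ (q : Measure ℝ) [IsFiniteMeasure q],
      IntegrableOn (fun x => h x * q.real (Ioo 0 x)) (Ioo 0 T) := fun q _ => by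
    simpa [Measure.toSignedMeasure_apply_measurable measurableSet_Ioo] using
      integrableOn_mul_signed hh q.toSignedMeasure
  simp only [Measure.toSignedMeasure_sub_apply measurableSet_Ioo, mul_sub]
  rw [integral_sub (hb p) (hb n), integral_mul_measureReal hh, integral_mul_measureReal hh,
    setIntegral_toSignedMeasure_sub _ _ measurableSet_Ioo (integrableOn_tailInt_measure hT hh p)
      (integrableOn_tailInt_measure hT hh n)]

/-- Integration against a density with respect to Lebesgue measure on `(0,T)`. -/
theorem setIntegral_densityMeasure {T : ℝ} {w f : ℝ → ℝ} (hw : IntegrableOn w (Ioo 0 T)) {C : ℝ}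
    (hf : AEStronglyMeasurable f (volume.restrict (Ioo 0 T))) (hC : ∀ x ∈ Ioo 0 T, ‖f x‖ ≤ C) :
    ∫ᵛ x in Ioo 0 T, f x ∂•(densityMeasure T w) = ∫ x in Ioo 0 T, f x * w x := by
  have hw' : Integrable w (volume.restrict (Ioo 0 T)) := hw
  have i1 := isFiniteMeasure_withDensity_ofReal hw'.2
  have i2 : IsFiniteMeasure ((volume.restrict (Ioo 0 T)).withDensity
    fun x => ENNReal.ofReal (-w x)) := isFiniteMeasure_withDensity_ofReal hw'.neg.2
  have hint : ∀ g : ℝ → ENNReal,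
      IsFiniteMeasure ((volume.restrict (Ioo 0 T)).withDensity g) →
      IntegrableOn f (Ioo 0 T) ((volume.restrict (Ioo 0 T)).withDensity g) := by
    intro g hg
    refine Integrable.of_bound ((hf.mono_ac ?_)) C
      ((ae_restrict_iff' measurableSet_Ioo).2 (.of_forall hC))
    exact Measure.restrict_le_self.absolutelyContinuous.trans
      (withDensity_absolutelyContinuous _ _)
  have hval : ∀ g : ℝ → ℝ, IntegrableOn g (Ioo 0 T) →
      ∫ x in Ioo 0 T, f x ∂((volume.restrict (Ioo 0 T)).withDensity fun x => ENNReal.ofReal (g x))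
        = ∫ x in Ioo 0 T, f x * max (g x) 0 := by
    intro g hg
    rw [restrict_withDensity measurableSet_Ioo, Measure.restrict_restrict measurableSet_Ioo,
      inter_self, integral_withDensity_eq_integral_toReal_smul₀
        hg.integrable.1.aemeasurable.ennreal_ofReal (by simp)]
    simp [ENNReal.toReal_ofReal', mul_comm]
  have hfw : ∀ g : ℝ → ℝ, IntegrableOn g (Ioo 0 T) →
      IntegrableOn (fun x => f x * max (g x) 0) (Ioo 0 T) := fun g hg =>
    hg.integrable.pos_part.bdd_mul hf ((ae_restrict_iff' measurableSet_Ioo).2 (.of_forall hC))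
  -- Split w into positive and negative parts, each the density of a finite measure.
  rw [densityMeasure, withDensityᵥ_eq_withDensity_pos_part_sub_withDensity_neg_part hw',
    setIntegral_toSignedMeasure_sub _ _ measurableSet_Ioo (hint _ i1) (hint _ i2), hval _ hw,
    hval (fun x => -w x) hw.neg, ← integral_sub (hfw _ hw) (hfw (fun x => -w x) hw.neg)]
  congr 1 with x
  rw [← mul_sub]
  congr 1
  rcases le_total 0 (w x) with h | h <;> simp [h]

/-! ### Test functions and the lemma of du Bois-Reymond. -/

theorem tailInt_deriv {T : ℝ} {ψ : ℝ → ℝ} (hψ : ContDiff ℝ ∞ ψ)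
    (hsupp : tsupport ψ ⊆ Ioo 0 T) {y : ℝ} (hy : y ≤ T) : tailInt T (deriv ψ) y = -ψ y := by
  have hT : ψ T = 0 := image_eq_zero_of_notMem_tsupport fun h => lt_irrefl _ (hsupp h).2
  rw [tailInt, ← integral_Ioc_eq_integral_Ioo, ← intervalIntegral.integral_of_le hy,
    intervalIntegral.integral_deriv_eq_sub (fun x _ => hψ.differentiable (by simp) x)
      ((hψ.continuous_deriv (by simp)).intervalIntegrable _ _), hT, zero_sub]

theorem integral_deriv_test {T : ℝ} (hT : 0 < T) {ψ : ℝ → ℝ} (hψ : ContDiff ℝ ∞ ψ)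
    (hsupp : tsupport ψ ⊆ Ioo 0 T) : ∫ x in Ioo 0 T, deriv ψ x = 0 := by
  have := tailInt_deriv hψ hsupp hT.le
  rwa [image_eq_zero_of_notMem_tsupport fun h => lt_irrefl _ (hsupp h).1, neg_zero] at this

theorem integrableOn_deriv_test {T : ℝ} {ψ : ℝ → ℝ} (hψ : ContDiff ℝ ∞ ψ) :
    IntegrableOn (deriv ψ) (Ioo 0 T) :=
  ((hψ.continuous_deriv (by simp)).integrableOn_Icc).mono_set Ioo_subset_Icc_self

theorem integral_deriv_mul_signed {T : ℝ} (hT : 0 < T) {ψ : ℝ → ℝ} (hψ : ContDiff ℝ ∞ ψ)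
    (hsupp : tsupport ψ ⊆ Ioo 0 T) (μ : SignedMeasure ℝ) :
    ∫ x in Ioo 0 T, deriv ψ x * μ (Ioo 0 x) = -∫ᵛ x, ψ x ∂•μ := by
  rw [integral_mul_signed hT (integrableOn_deriv_test hψ),
    VectorMeasure.setIntegral_congr_fun (g := fun y => -ψ y)
      (fun y hy => tailInt_deriv hψ hsupp hy.2.le),
    VectorMeasure.integral_fun_neg,
    VectorMeasure.setIntegral_eq_integral_of_forall_compl_eq_zero measurableSet_Ioo fun x hx =>
      image_eq_zero_of_notMem_tsupport fun h => hx (hsupp h)]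

theorem integrableOn_signed (T : ℝ) (μ : SignedMeasure ℝ) :
    IntegrableOn (fun x => μ (Ioo 0 x)) (Ioo 0 T) :=
  Integrable.of_bound (measurable_signed_Ioo μ).aestronglyMeasurable μ.bound
    (.of_forall fun _ => VectorMeasure.norm_apply_le_bound)

theorem integrableOn_const_Ioo (T c : ℝ) : IntegrableOn (fun _ : ℝ => c) (Ioo 0 T) :=
  integrableOn_const (by simp)

/-- The distribution function of a signed measure has that measure as derivative. -/
theorem hasMeasureDeriv_of_eq {T : ℝ} (hT : 0 < T) {u : ℝ → ℝ} {μ : SignedMeasure ℝ} (c : ℝ)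
    (hu : ∀ x ∈ Ioo 0 T, u x = c + μ (Ioo 0 x)) : HasMeasureDeriv T u μ := by
  refine ⟨((integrableOn_const_Ioo T c).add (integrableOn_signed T μ)).congr_fun
    (fun x hx => (hu x hx).symm) measurableSet_Ioo, fun ψ hψ _ hsupp => ?_⟩
  have h1 : ∫ x in Ioo 0 T, u x * deriv ψ x =
      ∫ x in Ioo 0 T, (c * deriv ψ x + deriv ψ x * μ (Ioo 0 x)) :=
    setIntegral_congr_fun measurableSet_Ioo fun x hx => by
      simp only [hu x hx]; ring
  rw [h1, integral_add ((integrableOn_deriv_test hψ).integrable.const_mul c)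
    (integrableOn_mul_signed (integrableOn_deriv_test hψ) μ), integral_const_mul,
    integral_deriv_test hT hψ hsupp, integral_deriv_mul_signed hT hψ hsupp]
  ring

theorem exists_Icc_of_isCompact {T : ℝ} (hT : 0 < T) {K : Set ℝ} (hK : IsCompact K)
    (hKT : K ⊆ Ioo 0 T) : ∃ a b, 0 < a ∧ b < T ∧ K ⊆ Icc a b := by
  rcases K.eq_empty_or_nonempty with rfl | hne
  -- Reversed endpoints are harmless here: only 0 < a and b < T are required.
  · exact ⟨T, 0, hT, hT, by simp⟩
  · obtain ⟨a, ha⟩ := hK.exists_isLeast hne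
    obtain ⟨b, hb⟩ := hK.exists_isGreatest hne
    exact ⟨a, b, (hKT ha.1).1, (hKT hb.1).2, fun x hx => ⟨ha.2 hx, hb.2 hx⟩⟩

/-- A test function with vanishing integral is the derivative of a test function. -/
theorem exists_test_primitive {T : ℝ} (hT : 0 < T) {g : ℝ → ℝ} (hg : ContDiff ℝ ∞ g)
    (hc : HasCompactSupport g) (hsupp : tsupport g ⊆ Ioo 0 T)
    (h0 : ∫ x in Ioo 0 T, g x = 0) :
    ∃ ψ : ℝ → ℝ, ContDiff ℝ ∞ ψ ∧ HasCompactSupport ψ ∧ tsupport ψ ⊆ Ioo 0 T ∧ deriv ψ = g := by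
  obtain ⟨a, b, ha, hb, hab⟩ := exists_Icc_of_isCompact hT hc hsupp
  have hzero : ∀ x, x ∉ Icc a b → g x = 0 := fun x hx =>
    image_eq_zero_of_notMem_tsupport fun h => hx (hab h)
  let ψ : ℝ → ℝ := fun x => ∫ t in 0..x, g t
  have hd : ∀ x, HasDerivAt ψ (g x) x := fun x =>
    intervalIntegral.integral_hasDerivAt_right (hg.continuous.intervalIntegrable _ _)
      hg.continuous.stronglyMeasurable.stronglyMeasurableAtFilter hg.continuous.continuousAt
  have hder : deriv ψ = g := funext fun x => (hd x).deriv
  have hT0 : ∫ t in 0..T, g t = 0 := by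
    rw [intervalIntegral.integral_of_le hT.le, integral_Ioc_eq_integral_Ioo, h0]
  -- Left of a the integrand is zero; right of b the primitive equals the total integral, which is
  -- zero.
  have hs : Function.support ψ ⊆ Icc a b := by
    intro x hx
    by_contra hxab
    apply hx
    rcases lt_or_ge x a with h | h
    · refine (intervalIntegral.integral_congr (g := fun _ => 0) fun t ht => hzero t ?_).trans
        (by simp)
      rw [mem_uIcc] at ht
      rintro ⟨h1, h2⟩
      rcases ht with ht | ht <;> linarith [ht.1, ht.2]
    · have hbx : b < x := by
        by_contra hbx
        exact hxab ⟨h, not_lt.1 hbx⟩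
      have : ψ x = (∫ t in 0..T, g t) + ∫ t in T..x, g t :=
        (intervalIntegral.integral_add_adjacent_intervals
          (hg.continuous.intervalIntegrable _ _) (hg.continuous.intervalIntegrable _ _)).symm
      rw [this, hT0, zero_add]
      refine (intervalIntegral.integral_congr (g := fun _ => 0) fun t ht => hzero t ?_).trans
        (by simp)
      rw [mem_uIcc] at ht
      rintro ⟨h1, h2⟩
      rcases ht with ht | ht <;> linarith [ht.1, ht.2]
  have hts : tsupport ψ ⊆ Icc a b := closure_minimal hs isClosed_Icc
  refine ⟨ψ, ?_, isCompact_Icc.of_isClosed_subset (isClosed_tsupport _) hts,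
    hts.trans fun x hx => ⟨ha.trans_le hx.1, hx.2.trans_lt hb⟩, hder⟩
  rw [contDiff_infty_iff_deriv, hder]
  exact ⟨fun x => (hd x).differentiableAt, hg⟩

theorem exists_test_integral_one {T : ℝ} (hT : 0 < T) :
    ∃ ρ : ℝ → ℝ, ContDiff ℝ ∞ ρ ∧ HasCompactSupport ρ ∧ tsupport ρ ⊆ Ioo 0 T ∧
      ∫ x in Ioo 0 T, ρ x = 1 := by
  let f : ContDiffBump (T / 2) := ⟨T / 8, T / 4, by positivity, by linarith⟩
  have hsupp : tsupport (f.normed volume) ⊆ Ioo 0 T := by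
    rw [f.tsupport_normed_eq, Real.closedBall_eq_Icc]
    intro x hx
    have h1 : T / 2 - T / 4 ≤ x := hx.1
    have h2 : x ≤ T / 2 + T / 4 := hx.2
    constructor <;> linarith
  refine ⟨f.normed volume, f.contDiff_normed, f.hasCompactSupport_normed, hsupp, ?_⟩
  rw [setIntegral_eq_integral_of_forall_compl_eq_zero fun x hx =>
    image_eq_zero_of_notMem_tsupport fun h => hx (hsupp h)]
  exact f.integral_normed

theorem integrableOn_mul_test {T : ℝ} {f g : ℝ → ℝ} (hf : IntegrableOn f (Ioo 0 T))
    (hg : Continuous g) (hc : HasCompactSupport g) :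
    IntegrableOn (fun x => f x * g x) (Ioo 0 T) := by
  obtain ⟨C, hC⟩ := hc.exists_bound_of_continuous hg
  exact hf.integrable.mul_bdd (c := C) hg.aestronglyMeasurable (.of_forall hC)

/-- The lemma of du Bois-Reymond. -/
theorem exists_ae_eq_const {T : ℝ} (hT : 0 < T) {f : ℝ → ℝ} (hf : IntegrableOn f (Ioo 0 T))
    (h : ∀ ψ : ℝ → ℝ, ContDiff ℝ ∞ ψ → HasCompactSupport ψ → tsupport ψ ⊆ Ioo 0 T →
      ∫ x in Ioo 0 T, f x * deriv ψ x = 0) :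
    ∃ c : ℝ, ∀ᵐ x ∂volume.restrict (Ioo 0 T), f x = c := by
  obtain ⟨ρ, hρ, hρc, hρs, hρ1⟩ := exists_test_integral_one hT
  let c := ∫ x in Ioo 0 T, f x * ρ x
  refine ⟨c, (ae_restrict_iff' measurableSet_Ioo).2 ?_⟩
  have hfc : IntegrableOn (fun x => f x - c) (Ioo 0 T) := hf.sub (integrableOn_const_Ioo T c)
  have := isOpen_Ioo.ae_eq_zero_of_integral_contDiff_smul_eq_zero (μ := volume)
    (hfc.locallyIntegrableOn) fun η hη hηc hηs => ?_
  · filter_upwards [this] with x hx hxT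
    exact sub_eq_zero.1 (hx hxT)
  -- Subtracting e • ρ gives η mean zero, hence makes it a derivative of a test function.
  let e := ∫ x in Ioo 0 T, η x
  let g : ℝ → ℝ := fun x => η x - e * ρ x
  have hηi : IntegrableOn η (Ioo 0 T) :=
    (hη.continuous.integrable_of_hasCompactSupport hηc).integrableOn
  have hρi : IntegrableOn ρ (Ioo 0 T) :=
    (hρ.continuous.integrable_of_hasCompactSupport hρc).integrableOn
  have hgs : tsupport g ⊆ tsupport η ∪ tsupport ρ := by
    refine closure_minimal (fun x hx => ?_) ((isClosed_tsupport _).union (isClosed_tsupport _))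
    by_contra hxn
    rw [mem_union, not_or] at hxn
    apply hx
    simp [g, image_eq_zero_of_notMem_tsupport hxn.1, image_eq_zero_of_notMem_tsupport hxn.2]
  obtain ⟨ψ, hψ, hψc, hψs, hψd⟩ := exists_test_primitive hT (g := g)
    (hη.sub (contDiff_const.mul hρ))
    ((hηc.isCompact.union hρc.isCompact).of_isClosed_subset (isClosed_tsupport _) hgs)
    (hgs.trans (union_subset hηs hρs)) (by
      rw [integral_sub hηi (hρi.integrable.const_mul e), integral_const_mul, hρ1]; simp [e])
  have h1 := h ψ hψ hψc hψs
  have h2 : ∫ x in Ioo 0 T, f x * deriv ψ x =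
      ∫ x in Ioo 0 T, (f x * η x - e * (f x * ρ x)) := by
    rw [hψd]; congr 1 with x; simp only [g]; ring
  rw [h2, integral_sub (integrableOn_mul_test hf hη.continuous hηc)
    ((integrableOn_mul_test hf hρ.continuous hρc).integrable.const_mul e),
    integral_const_mul] at h1
  rw [← setIntegral_eq_integral_of_forall_compl_eq_zero (s := Ioo 0 T) fun x hx => by
    rw [image_eq_zero_of_notMem_tsupport fun h => hx (hηs h), zero_smul]]
  have h3 : ∫ x in Ioo 0 T, η x • (f x - c) = ∫ x in Ioo 0 T, (f x * η x - c * η x) := by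
    congr 1 with x; simp only [smul_eq_mul]; ring
  rw [h3, integral_sub (integrableOn_mul_test hf hη.continuous hηc)
    (hηi.integrable.const_mul c), integral_const_mul]
  linarith [mul_comm c e]

/-! ### BV functions as distribution functions, and integration by parts. -/

/-- A function of bounded variation is, up to a constant, the distribution function of its
derivative. -/
theorem HasMeasureDeriv.exists_ae_eq {T : ℝ} (hT : 0 < T) {u : ℝ → ℝ} {μ : SignedMeasure ℝ}
    (hu : HasMeasureDeriv T u μ) :
    ∃ c : ℝ, ∀ᵐ x ∂volume.restrict (Ioo 0 T), u x = c + μ (Ioo 0 x) := by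
  obtain ⟨c, hc⟩ := exists_ae_eq_const hT (hu.1.sub (integrableOn_signed T μ))
    fun ψ hψ hψc hψs => by
      have h1 := hu.2 ψ hψ hψc hψs
      have h2 := integral_deriv_mul_signed hT hψ hψs μ
      have hdc : HasCompactSupport (deriv ψ) := hψc.deriv
      have h3 : ∫ x in Ioo 0 T, (u - fun x => μ (Ioo 0 x)) x * deriv ψ x =
          ∫ x in Ioo 0 T, (u x * deriv ψ x - deriv ψ x * μ (Ioo 0 x)) := by
        congr 1 with x; simp only [Pi.sub_apply]; ring
      rw [h3, integral_sub
        (integrableOn_mul_test hu.1 (hψ.continuous_deriv (by simp)) hdc)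
        (integrableOn_mul_signed (integrableOn_deriv_test hψ) μ), h1, h2, sub_self]
  refine ⟨c, ?_⟩
  filter_upwards [hc] with x hx
  simp only [Pi.sub_apply] at hx
  linarith

theorem HasMeasureDeriv.exists_bound {T : ℝ} (hT : 0 < T) {u : ℝ → ℝ} {μ : SignedMeasure ℝ}
    (hu : HasMeasureDeriv T u μ) : ∃ C : ℝ, ∀ᵐ x ∂volume.restrict (Ioo 0 T), ‖u x‖ ≤ C := by
  obtain ⟨c, hc⟩ := hu.exists_ae_eq hT
  refine ⟨‖c‖ + μ.bound, ?_⟩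
  filter_upwards [hc] with x hx
  rw [hx]
  exact (norm_add_le _ _).trans (by gcongr; exact VectorMeasure.norm_apply_le_bound)

theorem HasMeasureDeriv.memLp {T : ℝ} (hT : 0 < T) {u : ℝ → ℝ} {μ : SignedMeasure ℝ}
    (hu : HasMeasureDeriv T u μ) : MemLp u 2 (volume.restrict (Ioo 0 T)) := by
  obtain ⟨C, hC⟩ := hu.exists_bound hT
  exact MemLp.of_bound hu.1.1 C hC

/-- Integration by parts against a function with vanishing integral. -/
theorem HasMeasureDeriv.integral_mul {T : ℝ} (hT : 0 < T) {u : ℝ → ℝ} {μ : SignedMeasure ℝ}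
    (hu : HasMeasureDeriv T u μ) {h : ℝ → ℝ} (hh : IntegrableOn h (Ioo 0 T))
    (h0 : ∫ x in Ioo 0 T, h x = 0) :
    ∫ x in Ioo 0 T, h x * u x = ∫ᵛ y in Ioo 0 T, tailInt T h y ∂•μ := by
  obtain ⟨c, hc⟩ := hu.exists_ae_eq hT
  have h1 : ∫ x in Ioo 0 T, h x * u x = ∫ x in Ioo 0 T, (c * h x + h x * μ (Ioo 0 x)) := by
    refine integral_congr_ae ?_
    filter_upwards [hc] with x hx
    rw [hx]; ring
  rw [h1, integral_add (hh.integrable.const_mul c) (integrableOn_mul_signed hh μ),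
    integral_const_mul, h0, integral_mul_signed hT hh]
  ring

/-- The pairing with `φ` as a sum of integrals against `Du - w` and `Dw`. -/
theorem pairing_eq {T : ℝ} (hT : 0 < T) {φ : ℝ → ℝ} (hφ : IntegrableOn φ (Ioo 0 T))
    (h0 : ∫ x in Ioo 0 T, φ x = 0) (h1 : ∫ x in Ioo 0 T, tailInt T φ x = 0)
    {u w : ℝ → ℝ} {μ ν : SignedMeasure ℝ} (hu : HasMeasureDeriv T u μ)
    (hw : HasMeasureDeriv T w ν) :
    pairing T φ u = ∫ᵛ y in Ioo 0 T, tailInt T φ y ∂•(μ - densityMeasure T w) +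
      ∫ᵛ y in Ioo 0 T, tailInt T (tailInt T φ) y ∂•ν := by
  obtain ⟨C, hC⟩ := exists_bound_tailInt hT hφ
  -- The density contributes -∫ Φ w, which cancels ∫ Ψ dDw; the latter equals ∫ Φ w because Φ has
  -- mean zero.
  rw [VectorMeasure.restrict_sub, VectorMeasure.integral_sub_vectorMeasure
    (integrableOn_tailInt_signed hT hφ _) (integrableOn_tailInt_signed hT hφ _),
    setIntegral_densityMeasure hw.1 (aestronglyMeasurable_tailInt hT hφ _)
      (fun x hx => hC x (Ioo_subset_Icc_self hx)),
    hw.integral_mul hT (integrableOn_tailInt hT hφ) h1, sub_add_cancel, pairing,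
    hu.integral_mul hT hφ h0]

/-- Fubini with Lebesgue measure, whose distribution function is x. It turns orthogonality to x into
the vanishing mean of Φ. -/
theorem integral_tailInt_eq_integral_mul {T : ℝ} {h : ℝ → ℝ} (hh : IntegrableOn h (Ioo 0 T)) :
    ∫ x in Ioo 0 T, tailInt T h x = ∫ x in Ioo 0 T, h x * x := by
  have := integral_mul_measureReal hh (volume.restrict (Ioo 0 T))
  rw [Measure.restrict_restrict measurableSet_Ioo, inter_self] at this
  rw [← this]
  refine setIntegral_congr_fun measurableSet_Ioo fun x hx => ?_
  simp only [measureReal_restrict_apply measurableSet_Ioo, Ioo_inter_Ioo, max_self,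
    min_eq_left hx.2.le, Real.volume_real_Ioo_of_le hx.1.le, sub_zero]

/-! ### Jumps and kinks lie in the ball. -/

theorem TGV_le {T α β : ℝ} {u w : ℝ → ℝ} {μ ν : SignedMeasure ℝ} (hu : HasMeasureDeriv T u μ)
    (hw : HasMeasureDeriv T w ν) :
    TGV T α β u ≤ ENNReal.ofReal α * radonNorm T (μ - densityMeasure T w) +
      ENNReal.ofReal β * radonNorm T ν :=
  iInf_le_of_le μ <| iInf_le_of_le w <| iInf_le_of_le ν <| iInf_le_of_le hu <| iInf_le _ hw

theorem radonNorm_zero (T : ℝ) : radonNorm T 0 = 0 := by simp [radonNorm]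

theorem radonNorm_dirac {T x : ℝ} (hx : x ∈ Ioo 0 T) (a : ℝ) :
    radonNorm T (VectorMeasure.dirac x a) = ‖a‖ₑ := by
  simp [radonNorm, hx]

theorem densityMeasure_zero (T : ℝ) : densityMeasure T 0 = 0 := by
  simp [densityMeasure]

theorem hasMeasureDeriv_zero {T : ℝ} (hT : 0 < T) : HasMeasureDeriv T 0 0 :=
  hasMeasureDeriv_of_eq hT 0 (by simp)

theorem hasMeasureDeriv_jump {T x : ℝ} (hT : 0 < T) (hx : 0 < x) (a b : ℝ) :
    HasMeasureDeriv T (fun t => b + a * jumpFn T x t) (VectorMeasure.dirac x a) := by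
  refine hasMeasureDeriv_of_eq hT b fun t ht => ?_
  by_cases h : x < t
  · rw [VectorMeasure.dirac_apply_of_mem measurableSet_Ioo (mem_Ioo.2 ⟨hx, h⟩)]
    simp [jumpFn, h, ht.2]
  · rw [VectorMeasure.dirac_apply_of_notMem (by simp [h])]
    simp [jumpFn, h]

theorem ofReal_mul_enorm_le {a α : ℝ} (hα : 0 < α) (ha : |a| * α ≤ 1) :
    ENNReal.ofReal α * ‖a‖ₑ ≤ 1 := by
  rw [Real.enorm_eq_ofReal_abs, ← ENNReal.ofReal_mul hα.le, ENNReal.ofReal_le_one]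
  linarith [mul_comm α |a|]

/-- The competitor w = 0 leaves only the Dirac mass in Du. -/
theorem smul_jumpFn_mem_tgvBall {T α β x a : ℝ} (hT : 0 < T) (hα : 0 < α) (hx : x ∈ Ioo 0 T)
    (ha : |a| * α ≤ 1) : a • jumpFn T x ∈ tgvBall T α β := by
  have hu : HasMeasureDeriv T (a • jumpFn T x) (VectorMeasure.dirac x a) := by
    have := hasMeasureDeriv_jump hT hx.1 a 0
    simp only [zero_add] at this
    exact this
  refine ⟨⟨_, hu⟩, (TGV_le hu (hasMeasureDeriv_zero hT)).trans ?_⟩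
  rw [densityMeasure_zero, sub_zero, radonNorm_dirac hx, radonNorm_zero, mul_zero, add_zero]
  exact ofReal_mul_enorm_le hα ha

/-- The derivative of `K_x`, up to null sets. -/
noncomputable def kinkSlope (T x : ℝ) (t : ℝ) : ℝ :=
  (if x < T / 2 then -1 else 0) + jumpFn T x t

theorem hasMeasureDeriv_kinkSlope {T x : ℝ} (hT : 0 < T) (hx : 0 < x) (a : ℝ) :
    HasMeasureDeriv T (fun t => a * kinkSlope T x t) (VectorMeasure.dirac x a) := by
  simpa only [kinkSlope, mul_add] using
    hasMeasureDeriv_jump hT hx a (a * if x < T / 2 then -1 else 0)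

theorem integral_jumpFn {T x t : ℝ} (hx : 0 < x) (ht : t ∈ Ioo 0 T) :
    ∫ s in Ioo 0 t, jumpFn T x s = max (t - x) 0 := by
  rw [jumpFn, setIntegral_indicator measurableSet_Ioo, Ioo_inter_Ioo, max_eq_right hx.le,
    min_eq_left ht.2.le]
  simp [Measure.real, Real.volume_Ioo, ENNReal.toReal_ofReal']

theorem hasMeasureDeriv_kink {T x : ℝ} (hT : 0 < T) (hx : x ∈ Ioo 0 T) (a : ℝ) :
    HasMeasureDeriv T (a • kinkFn T x) (densityMeasure T fun t => a * kinkSlope T x t) := by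
  -- The constant is the limit of a K_x at 0 from the right.
  refine hasMeasureDeriv_of_eq hT (a * if x < T / 2 then x else 0) fun t ht => ?_
  have hw := (hasMeasureDeriv_kinkSlope hT hx.1 a).1
  have hj : IntegrableOn (jumpFn T x) (Ioo 0 t) :=
    (integrable_indicator_iff measurableSet_Ioo).2
      (integrableOn_const (by simp)) |>.integrableOn
  rw [densityMeasure, withDensityᵥ_apply hw measurableSet_Ioo,
    Measure.restrict_restrict measurableSet_Ioo, Ioo_inter_Ioo, max_self, min_eq_left ht.2.le,
    integral_const_mul, ← mul_add, Pi.smul_apply, smul_eq_mul]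
  congr 1
  simp only [kinkSlope]
  rw [integral_add (integrableOn_const_Ioo t _) hj, integral_jumpFn hx.1 ht]
  simp only [integral_const, measureReal_restrict_apply_univ,
    Real.volume_real_Ioo_of_le ht.1.le, kinkFn]
  split_ifs
  · by_cases h : t < x
    · simp [h, ht.1, h.le, sub_eq_add_neg]
    · simp [h, max_eq_left (sub_nonneg.2 (not_lt.1 h))]
      ring
  · by_cases h : x < t
    · simp [h, ht.2, max_eq_left (sub_nonneg.2 h.le)]
    · simp [h, max_eq_right (sub_nonpos.2 (not_lt.1 h))]

/-- The competitor w = Du kills the first term, and Dw is a Dirac mass at x. -/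
theorem smul_kinkFn_mem_tgvBall {T α β x a : ℝ} (hT : 0 < T) (hβ : 0 < β) (hx : x ∈ Ioo 0 T)
    (ha : |a| * β ≤ 1) : a • kinkFn T x ∈ tgvBall T α β := by
  have hu := hasMeasureDeriv_kink hT hx a
  refine ⟨⟨_, hu⟩, (TGV_le hu (hasMeasureDeriv_kinkSlope hT hx.1 a)).trans ?_⟩
  rw [sub_self, radonNorm_dirac hx, radonNorm_zero, mul_zero, zero_add]
  exact ofReal_mul_enorm_le hβ ha

/-! ### Pairings with jumps and kinks. -/

theorem pairing_smul (T : ℝ) (φ v : ℝ → ℝ) (a : ℝ) :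
    pairing T φ (a • v) = a * pairing T φ v := by
  rw [pairing, pairing, ← integral_const_mul]
  congr 1 with x
  simp only [Pi.smul_apply, smul_eq_mul]
  ring

theorem pairing_jumpFn {T x : ℝ} (φ : ℝ → ℝ) (hx : x ∈ Ioo 0 T) :
    pairing T φ (jumpFn T x) = tailInt T φ x := by
  have : ∀ t, φ t * jumpFn T x t = (Ioo x T).indicator φ t := by
    intro t; simp [jumpFn, indicator]
  simp only [pairing, this]
  rw [setIntegral_indicator measurableSet_Ioo, Ioo_inter_Ioo, max_eq_right hx.1.le, min_self,
    tailInt]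

/-- Taking w = Du in `pairing_eq` leaves the Dirac mass alone. The two forms of K_x differ by an
affine function up to sign, so they pair equally with φ. -/
theorem pairing_kinkFn {T x : ℝ} (hT : 0 < T) {φ : ℝ → ℝ} (hφ : IntegrableOn φ (Ioo 0 T))
    (h0 : ∫ x in Ioo 0 T, φ x = 0) (h1 : ∫ x in Ioo 0 T, tailInt T φ x = 0)
    (hx : x ∈ Ioo 0 T) : pairing T φ (kinkFn T x) = tailInt T (tailInt T φ) x := by
  have h := pairing_eq hT hφ h0 h1 (hasMeasureDeriv_kink hT hx 1)
    (hasMeasureDeriv_kinkSlope hT hx.1 1)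
  rw [one_smul, sub_self] at h
  rw [h]
  simp [VectorMeasure.restrict_dirac_of_mem measurableSet_Ioo hx,
    VectorMeasure.integral_dirac]

theorem extB_subset_tgvBall {T α β : ℝ} (hT : 0 < T) (hα : 0 < α) (hβ : 0 < β) :
    extB T α β ⊆ tgvBall T α β := by
  have hinv : ∀ {γ : ℝ}, 0 < γ → |γ⁻¹| * γ ≤ 1 ∧ |-γ⁻¹| * γ ≤ 1 := fun {γ} hγ => by
    rw [abs_neg, abs_of_pos (inv_pos.2 hγ), inv_mul_cancel₀ hγ.ne']
    exact ⟨le_rfl, le_rfl⟩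
  rintro u (⟨x, hx, rfl | rfl⟩ | ⟨x, hx, rfl | rfl⟩)
  · exact smul_jumpFn_mem_tgvBall hT hα hx (hinv hα).1
  · rw [← neg_smul]
    exact smul_jumpFn_mem_tgvBall hT hα hx (hinv hα).2
  all_goals
    have hβα : 0 < β / α := div_pos hβ hα
    have hx' : x ∈ Ioo 0 T := ⟨hβα.trans hx.1, by linarith [hx.2]⟩
  · exact smul_kinkFn_mem_tgvBall hT hβ hx' (hinv hβ).1
  · rw [← neg_smul]
    exact smul_kinkFn_mem_tgvBall hT hβ hx' (hinv hβ).2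

/-! ### Weak duality. -/

theorem enorm_setIntegral_signed_le {T : ℝ} (μ : SignedMeasure ℝ) {f : ℝ → ℝ} {C : ℝ}
    (hC : ∀ x ∈ Ioo 0 T, |f x| ≤ C) :
    ‖∫ᵛ x in Ioo 0 T, f x ∂•μ‖ₑ ≤ ENNReal.ofReal C * radonNorm T μ := by
  refine (VectorMeasure.enorm_setIntegral_le_of_enorm_le_const (C := ENNReal.ofReal C)
    fun x hx => ?_).trans ?_
  · rw [Real.enorm_eq_ofReal_abs]
    exact ENNReal.ofReal_le_ofReal (hC x hx)
  · rw [radonNorm]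
    gcongr
    exact mul_le_of_le_one_right' ContinuousLinearMap.opENorm_lsmul_le

/-- Weak duality: the pairing is controlled by `TGV`. -/
theorem enorm_pairing_le {T α β : ℝ} (hT : 0 < T) {φ : ℝ → ℝ}
    (hφ : IntegrableOn φ (Ioo 0 T)) (h0 : ∫ x in Ioo 0 T, φ x = 0)
    (h1 : ∫ x in Ioo 0 T, tailInt T φ x = 0) {M : ℝ} (hM : 0 ≤ M)
    (hΦ : ∀ x ∈ Ioo 0 T, |tailInt T φ x| ≤ M * α)
    (hΨ : ∀ x ∈ Ioo 0 T, |tailInt T (tailInt T φ) x| ≤ M * β) {u : ℝ → ℝ}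
    (hu : u ∈ tgvBall T α β) : ‖pairing T φ u‖ₑ ≤ ENNReal.ofReal M := by
  have key : ∀ (μ : SignedMeasure ℝ) (w : ℝ → ℝ) (ν : SignedMeasure ℝ),
      HasMeasureDeriv T u μ → HasMeasureDeriv T w ν → ‖pairing T φ u‖ₑ ≤
      (ENNReal.ofReal α * radonNorm T (μ - densityMeasure T w) +
        ENNReal.ofReal β * radonNorm T ν) * ENNReal.ofReal M := by
    intro μ w ν hμ hν
    rw [pairing_eq hT hφ h0 h1 hμ hν]
    refine (enorm_add_le _ _).trans ((add_le_add (enorm_setIntegral_signed_le _ hΦ)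
      (enorm_setIntegral_signed_le _ hΨ)).trans_eq ?_)
    rw [ENNReal.ofReal_mul hM, ENNReal.ofReal_mul hM]
    ring
  have hle : ‖pairing T φ u‖ₑ / ENNReal.ofReal M ≤ TGV T α β u :=
    le_iInf fun μ => le_iInf fun w => le_iInf fun ν => le_iInf fun hμ => le_iInf fun hν =>
      ENNReal.div_le_of_le_mul (key μ w ν hμ hν)
  have h2 := hle.trans hu.2
  rcases hM.eq_or_lt with rfl | hpos
  -- For M = 0 one cannot divide by M, but any single competitor makes the bound zero, even if its
  -- cost were infinite.
  · obtain ⟨μ, hμ⟩ := hu.1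
    simpa using key μ 0 0 hμ (hasMeasureDeriv_zero hT)
  · rwa [ENNReal.div_le_iff (by simpa using hpos) (by simp), one_mul] at h2

/-! ### Attainment on the candidate set. -/

theorem exists_mem_jumpSet_pairing_eq {T x : ℝ} (α : ℝ) (φ : ℝ → ℝ) (hx : x ∈ Ioo 0 T) :
    ∃ u ∈ jumpSet T α, pairing T φ u = -(α⁻¹ * |tailInt T φ x|) := by
  rcases le_total 0 (tailInt T φ x) with h | h
  · refine ⟨_, ⟨x, hx, .inr rfl⟩, ?_⟩
    rw [← neg_smul, pairing_smul, pairing_jumpFn φ hx, abs_of_nonneg h, neg_mul]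
  · refine ⟨_, ⟨x, hx, .inl rfl⟩, ?_⟩
    rw [pairing_smul, pairing_jumpFn φ hx, abs_of_nonpos h, mul_neg, neg_neg]

theorem exists_mem_kinkSet_pairing_eq {T α β x : ℝ} (hT : 0 < T) (hβα : 0 < β / α) {φ : ℝ → ℝ}
    (hφ : IntegrableOn φ (Ioo 0 T)) (h0 : ∫ x in Ioo 0 T, φ x = 0)
    (h1 : ∫ x in Ioo 0 T, tailInt T φ x = 0) (hx : x ∈ Ioo (β / α) (T - β / α)) :
    ∃ u ∈ kinkSet T α β, pairing T φ u = -(β⁻¹ * |tailInt T (tailInt T φ) x|) := by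
  have hx' : x ∈ Ioo 0 T := ⟨hβα.trans hx.1, by linarith [hx.2]⟩
  have hp := pairing_kinkFn hT hφ h0 h1 hx'
  rcases le_total 0 (tailInt T (tailInt T φ) x) with h | h
  · refine ⟨_, ⟨x, hx, .inr rfl⟩, ?_⟩
    rw [← neg_smul, pairing_smul, hp, abs_of_nonneg h, neg_mul]
  · refine ⟨_, ⟨x, hx, .inl rfl⟩, ?_⟩
    rw [pairing_smul, hp, abs_of_nonpos h, mul_neg, neg_neg]

/-- Mean zero allows the tail to be estimated from either endpoint. Applied to h = Φ, this confines
the useful kinks to (β/α, T - β/α). -/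
theorem abs_tailInt_le {T : ℝ} {h : ℝ → ℝ} (hh : IntegrableOn h (Ioo 0 T))
    (h0 : ∫ x in Ioo 0 T, h x = 0) {A : ℝ} (hA : ∀ x ∈ Icc 0 T, |h x| ≤ A) {x : ℝ}
    (hx : x ∈ Icc 0 T) : |tailInt T h x| ≤ A * x ∧ |tailInt T h x| ≤ A * (T - x) := by
  constructor
  · rw [tailInt_eq_sub hh hx.1 hx.2, tailInt, h0, zero_sub, abs_neg]
    have := intervalIntegral.norm_integral_le_of_norm_le_const (a := 0) (b := x) (f := h) (C := A)
      fun t ht => by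
        rw [uIoc_of_le hx.1] at ht
        exact hA t ⟨ht.1.le, ht.2.trans hx.2⟩
    rwa [sub_zero, abs_of_nonneg hx.1] at this
  · have := intervalIntegral.norm_integral_le_of_norm_le_const (a := x) (b := T) (f := h) (C := A)
      fun t ht => by
        rw [uIoc_of_le hx.2] at ht
        exact hA t ⟨hx.1.trans ht.1.le, ht.2⟩
    rwa [abs_of_nonneg (sub_nonneg.2 hx.2), intervalIntegral.integral_of_le hx.2,
      integral_Ioc_eq_integral_Ioo] at this

/-- The optimal value is attained on `extB`. -/
theorem exists_mem_extB_forall_pairing_le {T α β : ℝ} (hT : 0 < T) (hα : 0 < α) (hβ : 0 < β) {φ : ℝ → ℝ}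
    (hφ : IntegrableOn φ (Ioo 0 T)) (h0 : ∫ x in Ioo 0 T, φ x = 0)
    (h1 : ∫ x in Ioo 0 T, tailInt T φ x = 0) :
    ∃ e ∈ extB T α β, ∀ v ∈ tgvBall T α β, pairing T φ e ≤ pairing T φ v := by
  have hne : (Icc 0 T).Nonempty := nonempty_Icc.2 hT.le
  have hΦi := integrableOn_tailInt hT hφ
  obtain ⟨x₁, hx₁, hmax₁⟩ := isCompact_Icc.exists_isMaxOn hne (continuousOn_tailInt hT hφ).abs
  obtain ⟨x₂, hx₂, hmax₂⟩ := isCompact_Icc.exists_isMaxOn hne (continuousOn_tailInt hT hΦi).abs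
  have hA : ∀ x ∈ Icc 0 T, |tailInt T φ x| ≤ |tailInt T φ x₁| := fun x hx => hmax₁ hx
  have hB : ∀ x ∈ Icc 0 T, |tailInt T (tailInt T φ) x| ≤ |tailInt T (tailInt T φ) x₂| :=
    fun x hx => hmax₂ hx
  set A := |tailInt T φ x₁| with hAdef
  set B := |tailInt T (tailInt T φ) x₂| with hBdef
  have hA0 : 0 ≤ A := abs_nonneg _
  have hB0 : 0 ≤ B := abs_nonneg _
  -- By weak duality -M bounds the pairing below on the ball, so such an e is optimal.
  suffices ∃ e ∈ extB T α β, ∃ M, 0 ≤ M ∧ pairing T φ e ≤ -M ∧ A ≤ M * α ∧ B ≤ M * β by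
    obtain ⟨e, he, M, hM, heM, hAM, hBM⟩ := this
    refine ⟨e, he, fun v hv => heM.trans ?_⟩
    have := enorm_pairing_le hT hφ h0 h1 hM
      (fun x hx => (hA x (Ioo_subset_Icc_self hx)).trans hAM)
      (fun x hx => (hB x (Ioo_subset_Icc_self hx)).trans hBM) hv
    rw [Real.enorm_eq_ofReal_abs, ENNReal.ofReal_le_ofReal_iff hM] at this
    exact (abs_le.1 this).1
  -- This decides which of A/α and B/β is the larger, hence equals M.
  by_cases hcase : B ≤ α⁻¹ * A * β
  · have hex : ∃ x ∈ Ioo 0 T, A ≤ |tailInt T φ x| := by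
      by_cases hx : x₁ ∈ Ioo 0 T
      · exact ⟨x₁, hx, le_rfl⟩
      -- Φ vanishes at both endpoints, so a maximum there forces Φ = 0 and any interior point
      -- serves.
      · have : A = 0 := by
          have hx' : x₁ = 0 ∨ x₁ = T := by
            by_contra hcon
            rw [not_or] at hcon
            exact hx ⟨lt_of_le_of_ne hx₁.1 (Ne.symm hcon.1), lt_of_le_of_ne hx₁.2 hcon.2⟩
          rcases hx' with h | h
          · rw [hAdef, h, tailInt, h0, abs_zero]
          · rw [hAdef, h, tailInt_self, abs_zero]
        exact ⟨T / 2, ⟨by linarith, by linarith⟩, this ▸ abs_nonneg _⟩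
    obtain ⟨x, hx, hxA⟩ := hex
    obtain ⟨e, he, hp⟩ := exists_mem_jumpSet_pairing_eq α φ hx
    refine ⟨e, .inl he, α⁻¹ * A, by positivity, ?_, ?_, hcase⟩
    · rw [hp]; gcongr
    · rw [mul_right_comm, inv_mul_cancel₀ hα.ne', one_mul]
  · rw [not_le] at hcase
    have hlt : A * (β / α) < B := by
      calc A * (β / α) = α⁻¹ * A * β := by ring
        _ < B := hcase
    have hb := abs_tailInt_le hΦi h1 hA hx₂
    rw [← hBdef] at hb
    -- Cancel A in A β/α < B ≤ A x₂ and in A β/α < B ≤ A (T - x₂).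
    have hx : x₂ ∈ Ioo (β / α) (T - β / α) := by
      constructor
      · exact lt_of_mul_lt_mul_left (hlt.trans_le hb.1) hA0
      · linarith [lt_of_mul_lt_mul_left (hlt.trans_le hb.2) hA0]
    obtain ⟨e, he, hp⟩ := exists_mem_kinkSet_pairing_eq hT (div_pos hβ hα) hφ h0 h1 hx
    refine ⟨e, .inr he, β⁻¹ * B, by positivity, hp.le, ?_, ?_⟩
    · rw [inv_mul_eq_div, div_mul_eq_mul_div, le_div_iff₀ hβ]
      have : A * (β / α) * α = A * β := by rw [mul_assoc, div_mul_cancel₀ _ hα.ne']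
      nlinarith
    · rw [mul_right_comm, inv_mul_cancel₀ hβ.ne', one_mul]

end TGVLinear

theorem theorem4p1 (T α β : ℝ) (hT : 0 < T) (hα : 0 < α) (hβ : 0 < β)
    (φ : ℝ → ℝ) (hφ : MemLp φ 2 (volume.restrict (Ioo 0 T)))
    (horth : ∀ c d : ℝ, TGVLinear.pairing T φ (fun x => c * x + d) = 0) :
    -- the pairing with `φ` is well defined on the ball, since the ball lies in `L²(0,T)`
    (∀ v ∈ TGVLinear.tgvBall T α β, MemLp v 2 (volume.restrict (Ioo 0 T))) ∧
    -- the linear problem has a minimizer in the ball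
    (∃ v₀ ∈ TGVLinear.tgvBall T α β, ∀ v ∈ TGVLinear.tgvBall T α β,
      TGVLinear.pairing T φ v₀ ≤ TGVLinear.pairing T φ v) ∧
    -- both minima exist and they are equal
    (∃ m : ℝ, IsLeast (TGVLinear.pairing T φ '' TGVLinear.tgvBall T α β) m ∧
      IsLeast (TGVLinear.pairing T φ '' TGVLinear.extB T α β) m) := by
  have hφi : IntegrableOn φ (Ioo 0 T) := hφ.integrable one_le_two
  have h0 : ∫ x in Ioo 0 T, φ x = 0 := by simpa [TGVLinear.pairing] using horth 0 1
  have h1 : ∫ x in Ioo 0 T, TGVLinear.tailInt T φ x = 0 := by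
    rw [TGVLinear.integral_tailInt_eq_integral_mul hφi]
    simpa [TGVLinear.pairing] using horth 1 0
  have hsub := TGVLinear.extB_subset_tgvBall hT hα hβ
  obtain ⟨e, he, hmin⟩ := TGVLinear.exists_mem_extB_forall_pairing_le hT hα hβ hφi h0 h1
  refine ⟨?_, ⟨e, hsub he, hmin⟩, TGVLinear.pairing T φ e, ⟨mem_image_of_mem _ (hsub he), ?_⟩,
    mem_image_of_mem _ he, ?_⟩
  · rintro v ⟨⟨μ, hμ⟩, -⟩
    exact hμ.memLp hT
  · rintro _ ⟨v, hv, rfl⟩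
    exact hmin v hv
  · rintro _ ⟨v, hv, rfl⟩
    exact hmin v (hsub hv)
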